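/- \textbf{Theorem.} Let $(X,Y)\sim\mathbb P$ take values in $\mathbb R^d\times\{0,1\}$, let $\mathbb P_X$ be the law of $X$ and $\eta(x)=\mathbb P(Y=1\mid X=x)$. For a classifier (measurable function) $g:\mathbb R^d\to\{0,1\}$ put $$F_1(g)=\frac{\mathbb P(Y=1,\,g(X)=1)}{\mathbb P(Y=1)+\mathbb P(g(X)=1)},\qquad \mathcal E_1(g)=\max_{h}F_1(h)-F_1(g),$$ the maximum being over all classifiers $h$, and let $\theta^*\in[0,1]$ be the unique root of $\theta\,\mathbb P(Y=1)=\mathbb E(\eta(X)-\theta)_+$. Let $\alpha\ge 0$, $C_0,C_1,C_2,p>0$ and $\delta_0\in(0,1/12]$. There is a constant $C>0$, depending only on $\alpha,C_0,\delta_0,C_1,C_2,p$, such that the following holds for every $d$ and every $\mathbb P$ as above. Assume that (i) $\mathbb P(Y=1)\ge p$; (ii) ($\alpha$-margin) $\mathbb P_X(0<|\eta(X)-\theta^*|\le\delta)\le C_0\,\delta^{\alpha}$ for all $0<\delta\le\delta_0$; (iii) $(a_n)_{n\ge1}$ is an increasing sequence of positive reals and, for every $n\ge1$, $\hat\eta=\hat\eta_n$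 is a real-valued estimator based on an i.i.d. sample $\mathcal D_n=\{(X_i,Y_i)\}_{i=1}^n$ from $\mathbb P$ with, for all $t>0$, $$\mathbb P^{\otimes n}\big(|\hat\eta(x)-\eta(x)|\ge t\big)\le C_1\exp(-C_2a_nt^2)\quad\text{for }\mathbb P_X\text{-almost every }x.$$ For $n,N\ge1$ let $\mathcal D_N=\{X_i\}_{i=n+1}^{n+N}$ be an i.i.d. sample from $\mathbb P_X$, independent of $\mathcal D_n$, and let $\hat\theta=\hat\theta(\mathcal D_n,\mathcal D_N)$ be a measurable function of the samples equal to the unique solution $\theta\in\mathbb R$ of $$\theta\,\frac1N\sum_{X_i\in\mathcal D_N}\hat\eta(X_i)=\frac1N\sum_{X_i\in\mathcal D_N}(\hat\eta(X_i)-\theta)_+$$ whenever this equation has exactly one solution (and arbitrary otherwise). Then the plug-in classifier $\hat g(x)=\mathbf 1\{\hat\eta(x)>\hat\theta\}$ satisfies $$\mathbb E_{(\mathcal D_n,\mathcal D_N)}\,\mathcal E_1(\hat g)\le C\left(a_n^{-\frac{1+\alpha}{2}}+N^{-\frac{1+\alpha}{2}}\right),$$ where the expectation is with respect to $\mathbb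 P^{\otimes n}\otimes\mathbb P_X^{\otimes N}$. -/

import Mathlib

open MeasureTheory

noncomputable section

namespace FScore

/-- The feature space `ℝ^d`. -/
abbrev Feature (d : ℕ) : Type := EuclideanSpace ℝ (Fin d)

/-- Pairs (feature, label); the label set `{0, 1}` is `Fin 2`. -/
abbrev Labeled (d : ℕ) : Type := Feature d × Fin 2

/-- `ℙ(Y = 1)`. -/
def probOne {d : ℕ} (P : Measure (Labeled d)) : ℝ :=
  P.real {z | z.2 = 1}

/-- The regression function `η(x) = ℙ(Y = 1 | X = x)`, through the regular conditional
distribution of the label given the feature. -/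
def eta {d : ℕ} (P : Measure (Labeled d)) [IsProbabilityMeasure P] (x : Feature d) : ℝ :=
  (P.condKernel x).real {1}

/-- The optimal threshold: the root `θ ∈ [0, 1]` of `θ ℙ(Y = 1) = 𝔼 (η(X) - θ)₊`. The root exists
and is unique whenever `ℙ(Y = 1) ≠ 0`, so the infimum is over a one-point set. -/
def thetaStar {d : ℕ} (P : Measure (Labeled d)) [IsProbabilityMeasure P] : ℝ :=
  sInf {θ : ℝ | θ ∈ Set.Icc (0 : ℝ) 1 ∧ θ * probOne P = ∫ x, max (eta P x - θ) 0 ∂P.fst}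

/-- The (normalised) `F₁`-score of a classifier `g`. -/
def fOne {d : ℕ} (P : Measure (Labeled d)) (g : Feature d → Fin 2) : ℝ :=
  P.real {z | z.2 = 1 ∧ g z.1 = 1} / (probOne P + P.real {z | g z.1 = 1})

/-- The excess score: the best `F₁`-score over all measurable classifiers (the score of a
Bayes-optimal classifier), minus the score of `g`. -/
def excess {d : ℕ} (P : Measure (Labeled d)) (g : Feature d → Fin 2) : ℝ :=
  (⨆ h : {h : Feature d → Fin 2 // Measurable h}, fOne P h.1) - fOne P g

/-- The `α`-margin condition around the optimal threshold, with constants `C₀` and `δ₀`. -/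
def MarginCondition {d : ℕ} (P : Measure (Labeled d)) [IsProbabilityMeasure P]
    (α C₀ δ₀ : ℝ) : Prop :=
  ∀ δ : ℝ, 0 < δ → δ ≤ δ₀ →
    P.fst.real {x | 0 < |eta P x - thetaStar P| ∧ |eta P x - thetaStar P| ≤ δ} ≤ C₀ * δ ^ α

/-- A (measurable) estimator of a real function on the feature space, based on a labeled sample
of size `n`. -/
structure RegressionEstimator (d n : ℕ) where
  toFun : (Fin n → Labeled d) → Feature d → ℝ
  measurable : Measurable (Function.uncurry toFun)

/-- Sub-Gaussian pointwise deviation of `etaHat` from `η` at rate `a`, under `ℙ^{⊗n}`. -/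
def Concentrates {d n : ℕ} (P : Measure (Labeled d)) [IsProbabilityMeasure P]
    (etaHat : RegressionEstimator d n) (C₁ C₂ a : ℝ) : Prop :=
  ∀ t : ℝ, 0 < t → ∀ᵐ x ∂P.fst,
    (Measure.pi fun _ : Fin n => P).real {D | t ≤ |etaHat.toFun D x - eta P x|}
      ≤ C₁ * Real.exp (-C₂ * a * t ^ 2)

/-- The equation `θ · N⁻¹ ∑ f(Xᵢ) = N⁻¹ ∑ (f(Xᵢ) - θ)₊` on an unlabeled sample. -/
def SolvesThreshold {d N : ℕ} (f : Feature d → ℝ) (X : Fin N → Feature d) (θ : ℝ) : Prop :=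
  θ * ((1 / (N : ℝ)) * ∑ i, f (X i)) = (1 / (N : ℝ)) * ∑ i, max (f (X i) - θ) 0

/-- A measurable function of the two samples that is the unique solution of the empirical
threshold equation. On samples for which the equation does not have exactly one solution (for
instance if the estimator vanishes at all unlabeled points) its value is arbitrary. -/
structure ThresholdEstimator {d n : ℕ} (etaHat : RegressionEstimator d n) (N : ℕ) where
  toFun : (Fin n → Labeled d) → (Fin N → Feature d) → ℝ
  measurable : Measurable (Function.uncurry toFun)
  solves : ∀ D X, (∃! θ : ℝ, SolvesThreshold (etaHat.toFun D) X θ) →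
    SolvesThreshold (etaHat.toFun D) X (toFun D X)

/-- The classifier `x ↦ 1{f(x) > θ}`. -/
def plugIn {d : ℕ} (f : Feature d → ℝ) (θ : ℝ) (x : Feature d) : Fin 2 :=
  open Classical in if θ < f x then 1 else 0

/-- The joint law `ℙ^{⊗n} ⊗ ℙ_X^{⊗N}` of the labeled and the unlabeled sample. -/
def sampleLaw {d : ℕ} (P : Measure (Labeled d)) [IsProbabilityMeasure P] (n N : ℕ) :
    Measure ((Fin n → Labeled d) × (Fin N → Feature d)) :=
  (Measure.pi fun _ : Fin n => P).prod (Measure.pi fun _ : Fin N => P.fst)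

end FScore

end

/-! The equation defining `θ*` linearises the ratio `F₁`: `(θ* - F₁(g)) (ℙ(Y=1) + ℙ(g=1))` is the
integral of `|η - θ*|` over the points where `g` disagrees with `1{η > θ*}` (`thetaStar_sub_fOne`).
Hence `F₁ ≤ θ*`, and the excess is at most `1/p` times that integral.

At a disagreement point of the plug-in rule, `|η - θ*| ≤ |η̂ - η| + |θ̂ - θ*|` holds. The empirical
threshold function grows with slope at least the empirical mean of `η̂`. If this mean is at least
`p/2`, then `|θ̂ - θ*|` is controlled by the value of that function at `θ*`, that is, by the mean of
`|η̂ - η|` and a centred i.i.d. mean. Otherwise the mean of `η̂` is far from `ℙ(Y=1)`, and this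
deviation already dominates `|η - θ*| ≤ 1`. So `|η - θ*| ≤ V` with `V` a sum of four deviations
(`abs_sub_le_of_misclassified`), each with Gaussian tails at rate `b = a_n` or `b = N`.

It remains to bound `𝔼 ∫ u 1{0 < u ≤ V}` for `u = |η - θ*|`. By Tonelli this is at most a constant
times `∫ u exp(-c b u²)` over `u > 0`, and peeling at scale `b^(-1/2)` with the margin condition
gives `b^(-(1+α)/2)`: one factor from the size of `u`, `α` factors from the mass. -/

/-! ### Gaussian integrals under a margin condition. -/

theorem summable_add_one_rpow_mul_exp_neg_sq (s : ℝ) {c : ℝ} (hc : 0 < c) :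
    Summable fun k : ℕ => ((k : ℝ) + 1) ^ s * Real.exp (-c * (k : ℝ) ^ 2) := by
  have h := (((summable_nat_add_iff 1).2
    (Real.summable_pow_mul_exp_neg_nat_mul ⌈s⌉₊ hc)).mul_left (Real.exp c))
  refine h.of_nonneg_of_le (fun k => by positivity) fun k => ?_
  have h1 : ((k : ℝ) + 1) ^ s ≤ ((k : ℝ) + 1) ^ ⌈s⌉₊ := by
    rw [← Real.rpow_natCast]
    exact Real.rpow_le_rpow_of_exponent_le (by linarith [k.cast_nonneg (α := ℝ)]) (Nat.le_ceil s)
  have hk : (k : ℝ) ≤ (k : ℝ) ^ 2 := by exact_mod_cast Nat.le_self_pow two_ne_zero k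
  have h2 : Real.exp (-c * (k : ℝ) ^ 2) ≤ Real.exp c * Real.exp (-c * ((k + 1 : ℕ) : ℝ)) := by
    rw [← Real.exp_add, Real.exp_le_exp]
    push_cast
    nlinarith
  calc _ ≤ ((k : ℝ) + 1) ^ ⌈s⌉₊ * (Real.exp c * Real.exp (-c * ((k + 1 : ℕ) : ℝ))) := by
        gcongr
    _ = _ := by push_cast; ring

/-- The series that controls Gaussian integrals under a margin condition. -/
noncomputable def marginSeries (s c : ℝ) : ℝ :=
  ∑' k : ℕ, ((k : ℝ) + 1) ^ s * Real.exp (-c * (k : ℝ) ^ 2)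

theorem marginSeries_nonneg (s c : ℝ) : 0 ≤ marginSeries s c :=
  tsum_nonneg fun k => by positivity

/-- Peeling at scale `b^(-1/2)`: where `k < u √b ≤ k + 1` the integrand is at most `(k+1)/√b ·
exp(-c k²)`, while the mass is at most `K ((k+1)/√b)^α`. The powers of `√b` factor out and leave
`marginSeries`. -/
theorem lintegral_mul_exp_neg_sq_le_of_margin {X : Type*} [MeasurableSpace X] (μ : Measure X)
    {u : X → ℝ} (hu : Measurable u) {α K c b : ℝ} (hK : 0 ≤ K) (hc : 0 < c) (hb : 0 < b)
    (hmargin : ∀ δ : ℝ, 0 < δ → μ {x | 0 < u x ∧ u x ≤ δ} ≤ ENNReal.ofReal (K * δ ^ α)) :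
    ∫⁻ x in {x | 0 < u x}, ENNReal.ofReal (u x * Real.exp (-c * b * u x ^ 2)) ∂μ
      ≤ ENNReal.ofReal (K * marginSeries (1 + α) c * b ^ (-(1 + α) / 2)) := by
  set r := √b with hr
  have hr0 : 0 < r := Real.sqrt_pos.2 hb
  have hrb : r ^ 2 = b := Real.sq_sqrt hb.le
  -- Whole sublevel sets replace the shells, since these are exactly the sets that the margin
  -- hypothesis bounds.
  set A : ℕ → Set X := fun k => {x | 0 < u x ∧ u x ≤ ((k : ℝ) + 1) / r} with hA
  have hAm : ∀ k, MeasurableSet (A k) := fun k =>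
    (measurableSet_lt measurable_const hu).inter (measurableSet_le hu measurable_const)
  set w : ℕ → ℝ := fun k => ((k : ℝ) + 1) / r * Real.exp (-c * (k : ℝ) ^ 2) with hw
  have hw0 : ∀ k, 0 ≤ w k := fun k => by positivity
  have hpt : ∀ x ∈ {x | 0 < u x}, ENNReal.ofReal (u x * Real.exp (-c * b * u x ^ 2)) ≤
      ∑' k, (A k).indicator (fun _ => ENNReal.ofReal (w k)) x := by
    intro x hx
    have hx : 0 < u x := hx
    have hur : 0 < u x * r := by positivity
    obtain ⟨k, hk⟩ : ∃ k, ⌈u x * r⌉₊ = k + 1 :=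
      Nat.exists_eq_succ_of_ne_zero (Nat.ceil_pos.2 hur).ne'
    have hk1 : u x * r ≤ (k : ℝ) + 1 := by
      have := Nat.le_ceil (u x * r); rw [hk] at this; exact_mod_cast this
    have hk2 : (k : ℝ) < u x * r := Nat.lt_ceil.1 (by omega)
    have hxA : x ∈ A k := ⟨hx, (le_div_iff₀ hr0).2 hk1⟩
    refine le_trans ?_ (ENNReal.le_tsum k)
    rw [Set.indicator_of_mem hxA]
    refine ENNReal.ofReal_le_ofReal (mul_le_mul hxA.2 ?_ (Real.exp_pos _).le (by positivity))
    rw [Real.exp_le_exp]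
    have : (k : ℝ) ^ 2 ≤ b * u x ^ 2 := by
      rw [← hrb, ← mul_pow, mul_comm r]
      exact pow_le_pow_left₀ k.cast_nonneg hk2.le 2
    nlinarith
  have hterm : ∀ k : ℕ, w k * (K * (((k : ℝ) + 1) / r) ^ α) =
      K * b ^ (-(1 + α) / 2) * (((k : ℝ) + 1) ^ (1 + α) * Real.exp (-c * (k : ℝ) ^ 2)) := by
    intro k
    have hk : (0 : ℝ) < (k : ℝ) + 1 := by positivity
    have h1 : b ^ (-(1 + α) / 2) = (r ^ (1 + α))⁻¹ := by
      rw [hr, Real.sqrt_eq_rpow, ← Real.rpow_mul hb.le, ← Real.rpow_neg hb.le]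
      congr 1; ring
    rw [h1, Real.div_rpow hk.le hr0.le, Real.rpow_add hk, Real.rpow_add hr0, Real.rpow_one,
      Real.rpow_one]
    have := (Real.rpow_pos_of_pos hr0 α).ne'
    simp only [hw]
    field_simp
  calc _ ≤ ∫⁻ x in {x | 0 < u x}, ∑' k, (A k).indicator (fun _ => ENNReal.ofReal (w k)) x ∂μ :=
        setLIntegral_mono' (measurableSet_lt measurable_const hu) hpt
    _ ≤ ∫⁻ x, ∑' k, (A k).indicator (fun _ => ENNReal.ofReal (w k)) x ∂μ :=
        setLIntegral_le_lintegral _ _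
    _ = ∑' k, ENNReal.ofReal (w k) * μ (A k) := by
        rw [lintegral_tsum fun k => (measurable_const.indicator (hAm k)).aemeasurable]
        simp_rw [lintegral_indicator_const (hAm _)]
    _ ≤ ∑' k, ENNReal.ofReal (w k * (K * (((k : ℝ) + 1) / r) ^ α)) := by
        refine ENNReal.tsum_le_tsum fun k => ?_
        rw [ENNReal.ofReal_mul (hw0 k)]
        gcongr
        exact hmargin _ (by positivity)
    _ = _ := by
        rw [← ENNReal.ofReal_tsum_of_nonneg (fun k => by have := hw0 k; positivity)]
        · simp_rw [hterm]
          rw [tsum_mul_left, marginSeries]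
          congr 1; ring
        · simp_rw [hterm]
          exact (summable_add_one_rpow_mul_exp_neg_sq _ hc).mul_left _

/-- The part of the mean of `u` where `0 < u ≤ V`. -/
noncomputable def marginPart {Ω X : Type*} (u : X → ℝ) (V : Ω → X → ℝ) (ω : Ω) (x : X) : ENNReal :=
  {x | 0 < u x ∧ u x ≤ V ω x}.indicator (fun x => ENNReal.ofReal (u x)) x

theorem measurable_marginPart {Ω X : Type*} [MeasurableSpace Ω] [MeasurableSpace X]
    {u : X → ℝ} (hu : Measurable u) {V : Ω → X → ℝ} (hV : Measurable (Function.uncurry V)) :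
    Measurable (Function.uncurry (marginPart u V)) :=
  ((hu.comp measurable_snd).ennreal_ofReal).indicator
    ((measurableSet_lt measurable_const (hu.comp measurable_snd)).inter
      (measurableSet_le (hu.comp measurable_snd) hV))

/-- A random deviation `V` with Gaussian tails at rate `b` contributes at most
`b ^ (-(1 + α) / 2)` to the mean of `u` over the points with `0 < u ≤ V`. -/
theorem lintegral_lintegral_margin_le {Ω X : Type*} [MeasurableSpace Ω] [MeasurableSpace X]
    (ν : Measure Ω) [SFinite ν] (μ : Measure X) [SFinite μ]
    {u : X → ℝ} (hu : Measurable u) {V : Ω → X → ℝ} (hV : Measurable (Function.uncurry V))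
    {α K A c b : ℝ} (hK : 0 ≤ K) (hA : 0 ≤ A) (hc : 0 < c) (hb : 0 < b)
    (hmargin : ∀ δ : ℝ, 0 < δ → μ {x | 0 < u x ∧ u x ≤ δ} ≤ ENNReal.ofReal (K * δ ^ α))
    (htail : ∀ᵐ x ∂μ, ∀ t : ℝ, 0 < t →
      ν {ω | t ≤ V ω x} ≤ ENNReal.ofReal (A * Real.exp (-c * b * t ^ 2))) :
    ∫⁻ ω, ∫⁻ x, marginPart u V ω x ∂μ ∂ν
      ≤ ENNReal.ofReal (A * (K * marginSeries (1 + α) c * b ^ (-(1 + α) / 2))) := by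
  have hm := measurable_marginPart hu hV
  -- With `x` fixed, the integral over `ω` is `u x` times the probability of `u x ≤ V`, so the tail
  -- bound is used at `t = u x`.
  rw [lintegral_lintegral_swap hm.aemeasurable]
  have hset : MeasurableSet {x | 0 < u x} := measurableSet_lt measurable_const hu
  calc _ ≤ ∫⁻ x, {x | 0 < u x}.indicator (fun x => ENNReal.ofReal A *
          ENNReal.ofReal (u x * Real.exp (-c * b * u x ^ 2))) x ∂μ := by
        refine lintegral_mono_ae ?_
        filter_upwards [htail] with x hx
        by_cases h0 : 0 < u x
        · rw [Set.indicator_of_mem (show x ∈ {x | 0 < u x} from h0)]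
          have : ∀ ω, marginPart u V ω x =
              {ω | u x ≤ V ω x}.indicator (fun _ => ENNReal.ofReal (u x)) ω := fun ω => by
            simp [marginPart, Set.indicator_apply, h0]
          simp_rw [this]
          have hmx : MeasurableSet {ω | u x ≤ V ω x} :=
            measurableSet_le measurable_const (hV.comp measurable_prodMk_right)
          rw [lintegral_indicator_const hmx, ← ENNReal.ofReal_mul hA]
          calc _ ≤ ENNReal.ofReal (u x) *
                ENNReal.ofReal (A * Real.exp (-c * b * u x ^ 2)) := by
                gcongr; exact hx _ h0
            _ = _ := by rw [← ENNReal.ofReal_mul h0.le]; congr 1; ring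
        · simp [marginPart, h0]
    _ = ENNReal.ofReal A * ∫⁻ x in {x | 0 < u x},
          ENNReal.ofReal (u x * Real.exp (-c * b * u x ^ 2)) ∂μ := by
        rw [lintegral_indicator hset, lintegral_const_mul' _ _ ENNReal.ofReal_ne_top]
    _ ≤ _ := by
        rw [ENNReal.ofReal_mul hA]
        gcongr
        exact lintegral_mul_exp_neg_sq_le_of_margin μ hu hK hc hb hmargin

/-- One of four summands is at least a quarter of the sum. This separates deviations that
concentrate at different rates. -/
theorem indicator_margin_le {X : Type*} {u v₁ v₂ v₃ v₄ : X → ℝ} (x : X) :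
    {x | 0 < u x ∧ u x ≤ v₁ x + v₂ x + v₃ x + v₄ x}.indicator (fun x => ENNReal.ofReal (u x)) x ≤
      {x | 0 < u x ∧ u x ≤ 4 * v₁ x}.indicator (fun x => ENNReal.ofReal (u x)) x +
      {x | 0 < u x ∧ u x ≤ 4 * v₂ x}.indicator (fun x => ENNReal.ofReal (u x)) x +
      {x | 0 < u x ∧ u x ≤ 4 * v₃ x}.indicator (fun x => ENNReal.ofReal (u x)) x +
      {x | 0 < u x ∧ u x ≤ 4 * v₄ x}.indicator (fun x => ENNReal.ofReal (u x)) x := by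
  by_cases h : 0 < u x ∧ u x ≤ v₁ x + v₂ x + v₃ x + v₄ x
  · rw [Set.indicator_of_mem (by exact h)]
    by_cases h₁ : u x ≤ 4 * v₁ x
    · rw [Set.indicator_of_mem (s := {x | 0 < u x ∧ u x ≤ 4 * v₁ x}) (by exact ⟨h.1, h₁⟩), add_assoc,
        add_assoc]
      exact le_self_add
    by_cases h₂ : u x ≤ 4 * v₂ x
    · rw [Set.indicator_of_mem (s := {x | 0 < u x ∧ u x ≤ 4 * v₂ x}) (by exact ⟨h.1, h₂⟩), add_assoc]
      exact le_add_self.trans le_self_add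
    by_cases h₃ : u x ≤ 4 * v₃ x
    · rw [Set.indicator_of_mem (s := {x | 0 < u x ∧ u x ≤ 4 * v₃ x}) (by exact ⟨h.1, h₃⟩)]
      exact le_add_self.trans le_self_add
    have h₄ : u x ≤ 4 * v₄ x := by
      push Not at h₁ h₂ h₃
      linarith [h.2]
    rw [Set.indicator_of_mem (s := {x | 0 < u x ∧ u x ≤ 4 * v₄ x}) (by exact ⟨h.1, h₄⟩)]
    exact le_add_self
  · rw [Set.indicator_of_notMem (by exact h)]
    exact zero_le

theorem lintegral_lintegral_marginPart_add_le {Ω X : Type*} [MeasurableSpace Ω]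
    [MeasurableSpace X] (ν : Measure Ω) (μ : Measure X) [SFinite μ]
    {u : X → ℝ} (hu : Measurable u) {V₁ V₂ V₃ V₄ : Ω → X → ℝ}
    (h₁ : Measurable (Function.uncurry V₁)) (h₂ : Measurable (Function.uncurry V₂))
    (h₃ : Measurable (Function.uncurry V₃)) :
    ∫⁻ ω, ∫⁻ x, marginPart u (fun ω x => V₁ ω x + V₂ ω x + V₃ ω x + V₄ ω x) ω x ∂μ ∂ν ≤
      ∫⁻ ω, ∫⁻ x, marginPart u (fun ω x => 4 * V₁ ω x) ω x ∂μ ∂ν +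
      ∫⁻ ω, ∫⁻ x, marginPart u (fun ω x => 4 * V₂ ω x) ω x ∂μ ∂ν +
      ∫⁻ ω, ∫⁻ x, marginPart u (fun ω x => 4 * V₃ ω x) ω x ∂μ ∂ν +
      ∫⁻ ω, ∫⁻ x, marginPart u (fun ω x => 4 * V₄ ω x) ω x ∂μ ∂ν := by
  have m₁ := measurable_marginPart hu (V := fun ω x => 4 * V₁ ω x) (h₁.const_mul 4)
  have m₂ := measurable_marginPart hu (V := fun ω x => 4 * V₂ ω x) (h₂.const_mul 4)
  have m₃ := measurable_marginPart hu (V := fun ω x => 4 * V₃ ω x) (h₃.const_mul 4)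
  have i₁ := m₁.lintegral_prod_right' (ν := μ)
  have i₂ := m₂.lintegral_prod_right' (ν := μ)
  have i₃ := m₃.lintegral_prod_right' (ν := μ)
  simp only [Function.uncurry_apply_pair] at i₁ i₂ i₃
  have s₁ := fun ω => m₁.comp (measurable_prodMk_left (x := ω))
  have s₂ := fun ω => m₂.comp (measurable_prodMk_left (x := ω))
  have s₃ := fun ω => m₃.comp (measurable_prodMk_left (x := ω))
  simp only [Function.comp_def, Function.uncurry_apply_pair] at s₁ s₂ s₃
  have i₁₂ := i₁.add i₂
  have i₁₂₃ := i₁₂.add i₃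
  have s₁₂ := fun ω => (s₁ ω).add (s₂ ω)
  have s₁₂₃ := fun ω => (s₁₂ ω).add (s₃ ω)
  simp only [Pi.add_def] at i₁₂ i₁₂₃ s₁₂ s₁₂₃
  rw [← lintegral_add_left i₁, ← lintegral_add_left i₁₂, ← lintegral_add_left i₁₂₃]
  refine lintegral_mono fun ω => ?_
  beta_reduce
  rw [← lintegral_add_left (s₁ ω), ← lintegral_add_left (s₁₂ ω), ← lintegral_add_left (s₁₂₃ ω)]
  exact lintegral_mono fun x => indicator_margin_le x

/-! ### Concentration of empirical means. -/

/-- The square-exponential moment of a nonnegative variable with Gaussian tails. -/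
theorem lintegral_exp_mul_sq_le {Ω : Type*} [MeasurableSpace Ω] (ν : Measure Ω)
    [IsProbabilityMeasure ν] {W : Ω → ℝ} (hW : Measurable W) (hW0 : ∀ ω, 0 ≤ W ω)
    {A l : ℝ} (hA : 1 ≤ A) (hl : 0 < l)
    (htail : ∀ t : ℝ, 0 < t → ν.real {ω | t ≤ W ω} ≤ A * Real.exp (-(2 * l) * t ^ 2)) :
    ∫⁻ ω, ENNReal.ofReal (Real.exp (l * W ω ^ 2)) ∂ν
      ≤ ENNReal.ofReal (A * ∑' k : ℕ, Real.exp (1 - k)) := by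
  set B : ℕ → Set Ω := fun k => {ω | (k : ℝ) ≤ l * W ω ^ 2} with hB
  have hBm : ∀ k, MeasurableSet (B k) := fun k =>
    measurableSet_le measurable_const ((hW.pow_const 2).const_mul l)
  have hpt : ∀ ω, ENNReal.ofReal (Real.exp (l * W ω ^ 2)) ≤
      ∑' k, (B k).indicator (fun _ => ENNReal.ofReal (Real.exp (k + 1))) ω := by
    intro ω
    have h0 : 0 ≤ l * W ω ^ 2 := by positivity
    refine le_trans ?_ (ENNReal.le_tsum ⌊l * W ω ^ 2⌋₊)
    rw [Set.indicator_of_mem (show ω ∈ B _ from Nat.floor_le h0)]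
    exact ENNReal.ofReal_le_ofReal (Real.exp_le_exp.2 (Nat.lt_floor_add_one _).le)
  -- The tail rate is twice the moment rate, so `exp(-2k)` beats the layer height `exp(k+1)` and
  -- leaves the summable `exp(1-k)`. The layer `k = 0` has no tail bound and uses `1 ≤ A`.
  have hmeas : ∀ k, ν (B k) ≤ ENNReal.ofReal (A * Real.exp (-(2 * k))) := by
    intro k
    rcases Nat.eq_zero_or_pos k with rfl | hk
    · refine prob_le_one.trans ?_
      simpa using hA
    · have hk' : (0 : ℝ) < k := by exact_mod_cast hk
      have ht : 0 < √(k / l) := Real.sqrt_pos.2 (by positivity)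
      have := htail _ ht
      rw [Real.sq_sqrt (by positivity)] at this
      have hsub : B k ⊆ {ω | √(k / l) ≤ W ω} := fun ω hω => by
        refine Real.sqrt_le_iff.2 ⟨hW0 ω, (div_le_iff₀ hl).2 ?_⟩
        rw [mul_comm]; exact hω
      refine (measure_mono hsub).trans ?_
      rw [← ofReal_measureReal]
      refine ENNReal.ofReal_le_ofReal (this.trans_eq ?_)
      congr 2; field_simp
  have hsum : Summable fun k : ℕ => Real.exp (1 - (k : ℝ)) := by
    have := Real.summable_exp_neg_nat.mul_left (Real.exp 1)
    refine this.congr fun k => ?_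
    rw [← Real.exp_add, sub_eq_add_neg]
  calc _ ≤ ∫⁻ ω, ∑' k, (B k).indicator (fun _ => ENNReal.ofReal (Real.exp (k + 1))) ω ∂ν :=
        lintegral_mono hpt
    _ = ∑' k : ℕ, ENNReal.ofReal (Real.exp (k + 1)) * ν (B k) := by
        rw [lintegral_tsum fun k => (measurable_const.indicator (hBm k)).aemeasurable]
        simp_rw [lintegral_indicator_const (hBm _)]
    _ ≤ ∑' k : ℕ, ENNReal.ofReal (A * Real.exp (1 - k)) := by
        refine ENNReal.tsum_le_tsum fun k => ?_
        refine (mul_le_mul_right (hmeas k) _).trans_eq ?_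
        rw [← ENNReal.ofReal_mul (Real.exp_pos _).le, mul_left_comm, ← Real.exp_add]
        congr 3; ring
    _ = _ := by
        rw [← ENNReal.ofReal_tsum_of_nonneg (fun k => by positivity) (hsum.mul_left A),
          tsum_mul_left]

/-- Jensen for the square, then for `exp`. The errors of an estimator at the unlabeled points share
the labeled sample and are not independent; this inequality needs no independence. -/
theorem exp_mul_sq_mean_le {N : ℕ} (hN : 1 ≤ N) (w : Fin N → ℝ) {l : ℝ} (hl : 0 ≤ l) :
    Real.exp (l * ((1 / (N : ℝ)) * ∑ i, w i) ^ 2) ≤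
      (1 / (N : ℝ)) * ∑ i, Real.exp (l * w i ^ 2) := by
  have hN' : (0 : ℝ) < N := by exact_mod_cast hN
  have hone : ∑ _i : Fin N, (1 / (N : ℝ)) = 1 := by
    simp [hN'.ne']
  have h1 := (even_two.convexOn_pow (𝕜 := ℝ)).map_sum_le (t := Finset.univ)
      (w := fun _ => 1 / (N : ℝ))
      (p := w) (fun _ _ => by positivity) hone (fun _ _ => Set.mem_univ _)
  have h2 := convexOn_exp.map_sum_le (t := Finset.univ) (w := fun _ => 1 / (N : ℝ))
      (p := fun i => l * w i ^ 2) (fun _ _ => by positivity) hone (fun _ _ => Set.mem_univ _)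
  simp only [smul_eq_mul, ← Finset.mul_sum] at h1 h2
  refine le_trans (Real.exp_le_exp.2 ?_) h2
  calc _ ≤ l * (1 / (N : ℝ) * ∑ i, w i ^ 2) := by gcongr
    _ = _ := by ring

/-- Gaussian tails for the empirical mean of a random field over an independent sample. -/
theorem prod_pi_mean_ge_le {Ω X : Type*} [MeasurableSpace Ω] [MeasurableSpace X]
    (ν : Measure Ω) [IsProbabilityMeasure ν] (μ : Measure X) [IsProbabilityMeasure μ]
    {W : Ω → X → ℝ} (hW : Measurable (Function.uncurry W))
    {l M : ℝ} (hl : 0 < l)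
    (hexp : ∀ᵐ x ∂μ, ∫⁻ ω, ENNReal.ofReal (Real.exp (l * W ω x ^ 2)) ∂ν ≤ ENNReal.ofReal M)
    {N : ℕ} (hN : 1 ≤ N) {t : ℝ} (ht : 0 < t) :
    (ν.prod (Measure.pi fun _ : Fin N => μ)) {S | t ≤ (1 / (N : ℝ)) * ∑ i, W S.1 (S.2 i)}
      ≤ ENNReal.ofReal (M * Real.exp (-l * t ^ 2)) := by
  have hN' : (0 : ℝ) < N := by exact_mod_cast hN
  have hWi : ∀ i : Fin N, Measurable fun S : Ω × (Fin N → X) => W S.1 (S.2 i) := fun i =>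
    hW.comp (measurable_fst.prodMk ((measurable_pi_apply i).comp measurable_snd))
  have hei : ∀ i : Fin N, Measurable fun S : Ω × (Fin N → X) =>
      ENNReal.ofReal (Real.exp (l * W S.1 (S.2 i) ^ 2)) := fun i =>
    (Real.measurable_exp.comp (((hWi i).pow_const 2).const_mul l)).ennreal_ofReal
  have hi : ∀ i : Fin N, ∫⁻ S, ENNReal.ofReal (Real.exp (l * W S.1 (S.2 i) ^ 2))
      ∂(ν.prod (Measure.pi fun _ : Fin N => μ)) ≤ ENNReal.ofReal M := by
    intro i
    -- Integrating over `ω` first is possible because the sample is independent of it; each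
    -- coordinate has law `μ`, so an almost-everywhere bound in `x` suffices.
    rw [lintegral_prod_symm _ (hei i).aemeasurable]
    have hmp := measurePreserving_eval (fun _ : Fin N => μ) i
    have hg : Measurable fun x => ∫⁻ ω, ENNReal.ofReal (Real.exp (l * W ω x ^ 2)) ∂ν := by
      refine Measurable.lintegral_prod_left' (f := fun q : Ω × X =>
        ENNReal.ofReal (Real.exp (l * W q.1 q.2 ^ 2))) ?_
      exact (Real.measurable_exp.comp ((hW.pow_const 2).const_mul l)).ennreal_ofReal
    rw [hmp.lintegral_comp hg]
    exact (lintegral_mono_ae hexp).trans (by simp)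
  set f : Ω × (Fin N → X) → ENNReal := fun S =>
    ENNReal.ofReal (1 / (N : ℝ)) * ∑ i, ENNReal.ofReal (Real.exp (l * W S.1 (S.2 i) ^ 2)) with hf
  have hfm : Measurable f := (Finset.measurable_sum _ fun i _ => hei i).const_mul _
  have hfint : ∫⁻ S, f S ∂(ν.prod (Measure.pi fun _ : Fin N => μ)) ≤ ENNReal.ofReal M := by
    simp only [hf]
    rw [lintegral_const_mul _ (Finset.measurable_sum _ fun i _ => hei i),
      lintegral_finsetSum _ fun i _ => hei i]
    calc _ ≤ ENNReal.ofReal (1 / (N : ℝ)) * ∑ _i : Fin N, ENNReal.ofReal M := by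
          gcongr with i; exact hi i
      _ = ENNReal.ofReal (1 / (N : ℝ)) * (N * ENNReal.ofReal M) := by simp
      _ = ENNReal.ofReal M := by
          rw [← mul_assoc, ← ENNReal.ofReal_natCast, ← ENNReal.ofReal_mul (by positivity),
            one_div_mul_cancel hN'.ne', ENNReal.ofReal_one, one_mul]
  -- Chernoff's method with the squared mean: Markov's inequality is applied to the average `f`, so
  -- the bound is free of `N`.
  have hsub : {S : Ω × (Fin N → X) | t ≤ (1 / (N : ℝ)) * ∑ i, W S.1 (S.2 i)} ⊆
      {S | ENNReal.ofReal (Real.exp (l * t ^ 2)) ≤ f S} := by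
    intro S hS
    have hS : t ≤ (1 / (N : ℝ)) * ∑ i, W S.1 (S.2 i) := hS
    simp only [hf, Set.mem_ofPred_eq]
    rw [← ENNReal.ofReal_sum_of_nonneg fun i _ => (Real.exp_pos _).le,
      ← ENNReal.ofReal_mul (by positivity)]
    refine ENNReal.ofReal_le_ofReal (le_trans (Real.exp_le_exp.2 ?_)
      (exp_mul_sq_mean_le hN (fun i => W S.1 (S.2 i)) hl.le))
    gcongr
  calc _ ≤ _ := measure_mono hsub
    _ ≤ (∫⁻ S, f S ∂(ν.prod (Measure.pi fun _ : Fin N => μ))) /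
          ENNReal.ofReal (Real.exp (l * t ^ 2)) :=
        meas_ge_le_lintegral_div hfm.aemeasurable (by simp [Real.exp_pos]) ENNReal.ofReal_ne_top
    _ ≤ ENNReal.ofReal M / ENNReal.ofReal (Real.exp (l * t ^ 2)) := by gcongr
    _ = _ := by
        rw [← ENNReal.ofReal_div_of_pos (Real.exp_pos _), neg_mul, Real.exp_neg, div_eq_mul_inv]

/-- Hoeffding's inequality for `z` and `-z`; values in `[-1, 1]` give variance proxy `1`. -/
theorem pi_abs_mean_ge_le {X : Type*} [MeasurableSpace X] (μ : Measure X)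
    [IsProbabilityMeasure μ] {z : X → ℝ} (hz : Measurable z) (hz1 : ∀ᵐ x ∂μ, |z x| ≤ 1)
    (hz0 : ∫ x, z x ∂μ = 0) {N : ℕ} (hN : 1 ≤ N) {t : ℝ} (ht : 0 < t) :
    (Measure.pi fun _ : Fin N => μ) {x | t ≤ |(1 / (N : ℝ)) * ∑ i, z (x i)|}
      ≤ ENNReal.ofReal (2 * Real.exp (-(1 / 2) * N * t ^ 2)) := by
  have hN' : (0 : ℝ) < N := by exact_mod_cast hN
  have key : ∀ y : X → ℝ, Measurable y → (∀ᵐ x ∂μ, |y x| ≤ 1) → ∫ x, y x ∂μ = 0 →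
      (Measure.pi fun _ : Fin N => μ).real {x | t * N ≤ ∑ i, y (x i)}
        ≤ Real.exp (-(1 / 2) * N * t ^ 2) := by
    intro y hy hy1 hy0
    have hsg := ProbabilityTheory.hasSubgaussianMGF_of_mem_Icc_of_integral_eq_zero
      (μ := μ) (X := y) (a := -1) (b := 1) hy.aemeasurable
      (hy1.mono fun x hx => abs_le.1 hx) hy0
    have hind := ProbabilityTheory.iIndepFun_pi (μ := fun _ : Fin N => μ)
      (X := fun _ => y) fun _ => hy.aemeasurable
    have := ProbabilityTheory.HasSubgaussianMGF.measure_sum_ge_le_of_iIndepFun hind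
      (s := Finset.univ) (c := fun _ => (‖(1 : ℝ) - -1‖₊ / 2) ^ 2) (fun i _ => by
        refine ProbabilityTheory.HasSubgaussianMGF.of_map (Y := fun x : Fin N → X => x i)
          (X := y) (measurable_pi_apply i).aemeasurable ?_
        rw [(measurePreserving_eval (fun _ : Fin N => μ) i).map_eq]
        exact hsg) (ε := t * N) (by positivity)
    refine this.trans_eq ?_
    have h2 : ‖(1 : ℝ) - -1‖ = 2 := by norm_num
    congr 1
    simp only [Finset.sum_const, Finset.card_univ, Fintype.card_fin, nsmul_eq_mul]
    push_cast
    rw [h2]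
    field_simp
  have h1 := key z hz hz1 hz0
  have h2 := key (fun x => -z x) hz.neg (by simpa using hz1) (by rw [integral_neg, hz0, neg_zero])
  have hsub : {x : Fin N → X | t ≤ |(1 / (N : ℝ)) * ∑ i, z (x i)|} ⊆
      {x | t * N ≤ ∑ i, z (x i)} ∪ {x | t * N ≤ ∑ i, -z (x i)} := by
    intro x hx
    rcases le_abs.1 (show t ≤ |(1 / (N : ℝ)) * ∑ i, z (x i)| from hx) with h | h
    · left
      have : t ≤ (∑ i, z (x i)) / N := by rwa [one_div_mul_eq_div] at h
      exact (le_div_iff₀ hN').1 this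
    · right
      have : t ≤ (-∑ i, z (x i)) / N := by rwa [one_div_mul_eq_div, ← neg_div] at h
      simpa using (le_div_iff₀ hN').1 this
  refine (measure_mono hsub).trans ((measure_union_le _ _).trans ?_)
  rw [two_mul, ENNReal.ofReal_add (Real.exp_pos _).le (Real.exp_pos _).le]
  gcongr
  · rw [← ofReal_measureReal]; exact ENNReal.ofReal_le_ofReal h1
  · rw [← ofReal_measureReal]; exact ENNReal.ofReal_le_ofReal h2
-- The optimal threshold and the excess score.
namespace FScore

theorem real_classified_one {d : ℕ} (P : Measure (Labeled d)) {g : Feature d → Fin 2} (hg : Measurable g) :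
    P.real {z | g z.1 = 1} = P.fst.real {x | g x = 1} := by
  have hs : MeasurableSet {x | g x = 1} := hg (measurableSet_singleton 1)
  rw [measureReal_def, measureReal_def, Measure.fst_apply hs]
  rfl

theorem fOne_nonneg {d : ℕ} (P : Measure (Labeled d)) (g : Feature d → Fin 2) : 0 ≤ fOne P g :=
  div_nonneg measureReal_nonneg (add_nonneg measureReal_nonneg measureReal_nonneg)

section Score

variable {d : ℕ} (P : Measure (Labeled d)) [IsProbabilityMeasure P]

theorem measurable_eta : Measurable (eta P) :=
  (ProbabilityTheory.Kernel.measurable_coe _ (measurableSet_singleton 1)).ennreal_toReal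

theorem eta_nonneg (x : Feature d) : 0 ≤ eta P x := measureReal_nonneg

theorem eta_le_one (x : Feature d) : eta P x ≤ 1 := measureReal_le_one

theorem integrable_eta : Integrable (eta P) P.fst :=
  Integrable.of_mem_Icc 0 1 (measurable_eta P).aemeasurable
    (ae_of_all _ fun x => ⟨eta_nonneg P x, eta_le_one P x⟩)

theorem integrable_max_eta_sub (θ : ℝ) : Integrable (fun x => max (eta P x - θ) 0) P.fst :=
  ((integrable_eta P).sub (integrable_const θ)).pos_part

theorem setIntegral_eta {s : Set (Feature d)} (hs : MeasurableSet s) :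
    ∫ x in s, eta P x ∂P.fst = P.real (s ×ˢ {1}) := by
  have h := Measure.setLIntegral_condKernel_eq_measure_prod (ρ := P) hs
    (measurableSet_singleton (1 : Fin 2))
  rw [measureReal_def, ← h, integral_eq_lintegral_of_nonneg_ae
    (ae_of_all _ fun x => eta_nonneg P x) (measurable_eta P).aestronglyMeasurable]
  congr 1
  refine lintegral_congr fun x => ?_
  rw [eta, ofReal_measureReal]

theorem integral_eta : ∫ x, eta P x ∂P.fst = probOne P := by
  rw [← setIntegral_univ, setIntegral_eta P MeasurableSet.univ, probOne]
  congr 1; ext z; simp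

theorem real_label_one_and {g : Feature d → Fin 2} (hg : Measurable g) :
    P.real {z | z.2 = 1 ∧ g z.1 = 1} = ∫ x in {x | g x = 1}, eta P x ∂P.fst := by
  have hs : MeasurableSet {x | g x = 1} := hg (measurableSet_singleton 1)
  rw [setIntegral_eta P hs]
  congr 1; ext z; simp [and_comm]

/-- The difference of the two sides is continuous, equals `-ℙ(Y=1)` at `0` and `ℙ(Y=1)` at `1`, so
it has a root. The root set is compact, hence contains its infimum; uniqueness plays no role. -/
theorem thetaStar_mem :
    thetaStar P ∈ Set.Icc (0 : ℝ) 1 ∧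
      thetaStar P * probOne P = ∫ x, max (eta P x - thetaStar P) 0 ∂P.fst := by
  set φ : ℝ → ℝ := fun θ => θ * probOne P - ∫ x, max (eta P x - θ) 0 ∂P.fst with hφ
  have hlip : LipschitzWith 1 fun θ => ∫ x, max (eta P x - θ) 0 ∂P.fst := by
    refine LipschitzWith.of_dist_le_mul fun a b => ?_
    rw [Real.dist_eq, Real.dist_eq, NNReal.coe_one, one_mul,
      ← integral_sub (integrable_max_eta_sub P a) (integrable_max_eta_sub P b)]
    have := norm_integral_le_of_norm_le_const (μ := P.fst) (C := |a - b|)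
      (f := fun x => max (eta P x - a) 0 - max (eta P x - b) 0) (ae_of_all _ fun x => by
        rw [Real.norm_eq_abs]
        refine (abs_max_sub_max_le_abs _ _ _).trans_eq ?_
        rw [sub_sub_sub_cancel_left, abs_sub_comm])
    simpa using this
  have hcont : Continuous φ := (continuous_id.mul continuous_const).sub hlip.continuous
  have h0 : φ 0 ≤ 0 := by
    have : ∀ x, max (eta P x - 0) 0 = eta P x := fun x => by simp [eta_nonneg]
    simp only [hφ, this, integral_eta]
    simp [probOne]
  have h1 : 0 ≤ φ 1 := by
    have : ∀ x, max (eta P x - 1) 0 = 0 := fun x => by simp [eta_le_one]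
    simp only [hφ, this]
    simp [probOne]
  have hset : {θ : ℝ | θ ∈ Set.Icc (0 : ℝ) 1 ∧
      θ * probOne P = ∫ x, max (eta P x - θ) 0 ∂P.fst} = Set.Icc 0 1 ∩ φ ⁻¹' {0} := by
    ext θ; simp [hφ, sub_eq_zero]
  have hne : (Set.Icc 0 1 ∩ φ ⁻¹' {0}).Nonempty := by
    obtain ⟨θ, hθ, h⟩ := intermediate_value_Icc zero_le_one hcont.continuousOn ⟨h0, h1⟩
    exact ⟨θ, hθ, h⟩
  have hcomp : IsCompact (Set.Icc 0 1 ∩ φ ⁻¹' {0}) :=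
    isCompact_Icc.inter_right (isClosed_singleton.preimage hcont)
  have := hcomp.sInf_mem hne
  rw [← hset] at this
  exact this

theorem thetaStar_nonneg : 0 ≤ thetaStar P := (thetaStar_mem P).1.1

theorem thetaStar_le_one : thetaStar P ≤ 1 := (thetaStar_mem P).1.2

variable {P}

/-- The excess over the optimal threshold, as an integral over the region where the classifier
differs from the thresholded regression function. -/
theorem thetaStar_sub_fOne (hP : 0 < probOne P) {g : Feature d → Fin 2} (hg : Measurable g) :
    (thetaStar P - fOne P g) * (probOne P + P.real {z | g z.1 = 1}) =
      ∫ x, (max (eta P x - thetaStar P) 0 -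
        {x | g x = 1}.indicator (fun x => eta P x - thetaStar P) x) ∂P.fst := by
  have hs : MeasurableSet {x | g x = 1} := hg (measurableSet_singleton 1)
  have hi : Integrable (fun x => eta P x - thetaStar P) P.fst :=
    (integrable_eta P).sub (integrable_const _)
  -- The equation for `θ*` turns the positive-part integral into `θ* ℙ(Y=1)`, the missing part of
  -- the denominator.
  rw [integral_sub (integrable_max_eta_sub P _) (hi.indicator hs), ← (thetaStar_mem P).2,
    integral_indicator hs, integral_sub (integrable_eta P).integrableOn
      (integrable_const _).integrableOn, ← real_label_one_and P hg, setIntegral_const,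
    smul_eq_mul, ← real_classified_one P hg, fOne]
  have : probOne P + P.real {z | g z.1 = 1} ≠ 0 := by
    have := measureReal_nonneg (μ := P) (s := {z | g z.1 = 1})
    positivity
  field_simp
  ring

theorem fOne_le_thetaStar (hP : 0 < probOne P) {g : Feature d → Fin 2} (hg : Measurable g) :
    fOne P g ≤ thetaStar P := by
  have h := thetaStar_sub_fOne hP hg
  have h0 : 0 ≤ (thetaStar P - fOne P g) * (probOne P + P.real {z | g z.1 = 1}) := by
    rw [h]
    refine integral_nonneg fun x => ?_
    by_cases hx : g x = 1
    · simp [hx]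
    · simp [hx]
  have : 0 < probOne P + P.real {z | g z.1 = 1} := by
    have := measureReal_nonneg (μ := P) (s := {z | g z.1 = 1})
    positivity
  linarith [nonneg_of_mul_nonneg_left h0 this]

/-- Only the upper bound `F₁ ≤ θ*` enters; that some classifier attains it is not needed. -/
theorem excess_le_thetaStar_sub (hP : 0 < probOne P) (g : Feature d → Fin 2) :
    excess P g ≤ thetaStar P - fOne P g := by
  have : Nonempty {h : Feature d → Fin 2 // Measurable h} := ⟨⟨fun _ => 0, measurable_const⟩⟩
  have := ciSup_le fun h : {h : Feature d → Fin 2 // Measurable h} => fOne_le_thetaStar hP h.2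
  rw [excess]
  linarith

theorem excess_nonneg (hP : 0 < probOne P) {g : Feature d → Fin 2} (hg : Measurable g) :
    0 ≤ excess P g := by
  have := le_ciSup (f := fun h : {h : Feature d → Fin 2 // Measurable h} => fOne P h.1)
    ⟨thetaStar P, by rintro _ ⟨h, rfl⟩; exact fOne_le_thetaStar hP h.2⟩ ⟨g, hg⟩
  rw [excess]
  linarith

/-- If every misclassified point satisfies `|η - θ*| ≤ V`, the excess score is controlled by the
mean of `|η - θ*|` over the points with `0 < |η - θ*| ≤ V`. -/
theorem ofReal_excess_le {p : ℝ} (hp : 0 < p) (hP : p ≤ probOne P) {g : Feature d → Fin 2}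
    (hg : Measurable g) {V : Feature d → ℝ}
    (hV : ∀ x, ¬(g x = 1 ↔ thetaStar P < eta P x) → |eta P x - thetaStar P| ≤ V x) :
    ENNReal.ofReal (excess P g) ≤ ENNReal.ofReal (1 / p) *
      ∫⁻ x, {x | 0 < |eta P x - thetaStar P| ∧ |eta P x - thetaStar P| ≤ V x}.indicator
        (fun x => ENNReal.ofReal |eta P x - thetaStar P|) x ∂P.fst := by
  have hP0 := hp.trans_le hP
  have h := thetaStar_sub_fOne hP0 hg
  have hg0 := measureReal_nonneg (μ := P) (s := {z | g z.1 = 1})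
  have hle : p * excess P g ≤ ∫ x, (max (eta P x - thetaStar P) 0 -
        {x | g x = 1}.indicator (fun x => eta P x - thetaStar P) x) ∂P.fst := by
    rw [← h, mul_comm]
    have h1 := excess_le_thetaStar_sub hP0 g
    have h2 := excess_nonneg hP0 hg
    gcongr
    · linarith
    · linarith
  have hs : MeasurableSet {x | g x = 1} := hg (measurableSet_singleton 1)
  have hcancel : excess P g = 1 / p * (p * excess P g) := by field_simp
  rw [hcancel, ENNReal.ofReal_mul (by positivity)]
  gcongr
  refine (ENNReal.ofReal_le_ofReal hle).trans ?_
  rw [ofReal_integral_eq_lintegral_ofReal]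
  · refine lintegral_mono fun x => ?_
    -- The integrand vanishes at correctly classified points and where `η = θ*`; elsewhere it is at
    -- most `|η - θ*|`.
    by_cases hx : g x = 1 ↔ thetaStar P < eta P x
    · refine le_of_eq_of_le ?_ zero_le
      rw [ENNReal.ofReal_eq_zero]
      by_cases h1 : g x = 1
      · have := hx.1 h1
        simp [h1, this.le]
      · have : eta P x ≤ thetaStar P := not_lt.1 fun h => h1 (hx.2 h)
        simp [h1, this]
    · have hVx := hV x hx
      by_cases h0 : 0 < |eta P x - thetaStar P|
      · rw [Set.indicator_of_mem (show x ∈ {x | 0 < |eta P x - thetaStar P| ∧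
          |eta P x - thetaStar P| ≤ V x} from ⟨h0, hVx⟩)]
        refine ENNReal.ofReal_le_ofReal ?_
        by_cases h1 : g x = 1
        · have : eta P x ≤ thetaStar P := not_lt.1 fun h => hx (by simp [h1, h])
          have hm : max (eta P x - thetaStar P) 0 = 0 := max_eq_right (by linarith)
          simp only [Set.indicator_of_mem (show x ∈ {x | g x = 1} from h1), hm, zero_sub]
          exact neg_le_abs _
        · simp [h1, le_abs_self]
      · have h0 : eta P x - thetaStar P = 0 := by simpa using h0
        refine le_of_eq_of_le ?_ zero_le
        simp [Set.indicator_apply, h0]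
  · exact (integrable_max_eta_sub P _).sub
      (((integrable_eta P).sub (integrable_const _)).indicator hs)
  · refine ae_of_all _ fun x => ?_
    by_cases hx : g x = 1
    · simp [hx]
    · simp [hx]

/-- Peeling needs every scale. Beyond `δ₀` a probability is at most `1 ≤ (δ/δ₀)^α`, so enlarging the
constant is enough. -/
theorem margin_ofReal {α C₀ δ₀ : ℝ} (hα : 0 ≤ α) (hδ₀ : 0 < δ₀)
    (h : MarginCondition P α C₀ δ₀) {δ : ℝ} (hδ : 0 < δ) :
    P.fst {x | 0 < |eta P x - thetaStar P| ∧ |eta P x - thetaStar P| ≤ δ} ≤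
      ENNReal.ofReal (max C₀ ((δ₀ ^ α)⁻¹) * δ ^ α) := by
  have hδα : 0 < δ ^ α := Real.rpow_pos_of_pos hδ α
  have hδ₀α : 0 < δ₀ ^ α := Real.rpow_pos_of_pos hδ₀ α
  rw [← ofReal_measureReal]
  refine ENNReal.ofReal_le_ofReal ?_
  rcases le_total δ δ₀ with hle | hle
  · refine (h δ hδ hle).trans ?_
    gcongr
    exact le_max_left _ _
  · refine measureReal_le_one.trans ?_
    calc (1 : ℝ) = (δ₀ ^ α)⁻¹ * δ₀ ^ α := (inv_mul_cancel₀ hδ₀α.ne').symm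
      _ ≤ max C₀ ((δ₀ ^ α)⁻¹) * δ ^ α := by
        gcongr
        exact le_max_right _ _

/-- The centred score whose empirical mean drives the empirical threshold. -/
theorem integral_threshold_score :
    ∫ x, (thetaStar P * eta P x - max (eta P x - thetaStar P) 0) ∂P.fst = 0 := by
  rw [integral_sub ((integrable_eta P).const_mul _) (integrable_max_eta_sub P _),
    integral_const_mul, integral_eta, (thetaStar_mem P).2, sub_self]

theorem abs_threshold_score_le (x : Feature d) :
    |thetaStar P * eta P x - max (eta P x - thetaStar P) 0| ≤ 1 := by
  have h1 := thetaStar_nonneg P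
  have h2 := thetaStar_le_one P
  have h3 := eta_nonneg P x
  have h4 := eta_le_one P x
  have h5 : thetaStar P * eta P x ≤ 1 := mul_le_one₀ h2 h3 h4
  have h6 : 0 ≤ thetaStar P * eta P x := mul_nonneg h1 h3
  have h7 : max (eta P x - thetaStar P) 0 ≤ 1 := max_le (by linarith) zero_le_one
  have h8 : 0 ≤ max (eta P x - thetaStar P) 0 := le_max_right _ _
  exact abs_le.2 ⟨by linarith, by linarith⟩

end Score

/-! ### Stability of the empirical threshold. -/

section Threshold

variable {d N : ℕ}

theorem thresholdGap_le {f : Feature d → ℝ} (X : Fin N → Feature d) {a b : ℝ} (hab : a ≤ b) :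
    (b - a) * ((1 / (N : ℝ)) * ∑ i, f (X i)) ≤
      (b * ((1 / (N : ℝ)) * ∑ i, f (X i)) - (1 / (N : ℝ)) * ∑ i, max (f (X i) - b) 0) -
      (a * ((1 / (N : ℝ)) * ∑ i, f (X i)) - (1 / (N : ℝ)) * ∑ i, max (f (X i) - a) 0) := by
  have : (1 / (N : ℝ)) * ∑ i, max (f (X i) - b) 0 ≤ (1 / (N : ℝ)) * ∑ i, max (f (X i) - a) 0 := by
    gcongr
  linarith

theorem existsUnique_solvesThreshold {f : Feature d → ℝ} {X : Fin N → Feature d}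
    (h : 0 < (1 / (N : ℝ)) * ∑ i, f (X i)) : ∃! θ : ℝ, SolvesThreshold f X θ := by
  set m := (1 / (N : ℝ)) * ∑ i, f (X i) with hm
  set φ : ℝ → ℝ := fun θ => θ * m - (1 / (N : ℝ)) * ∑ i, max (f (X i) - θ) 0 with hφ
  have hmono : ∀ {a b : ℝ}, a ≤ b → (b - a) * m ≤ φ b - φ a := fun hab => thresholdGap_le X hab
  have hcont : Continuous φ := by fun_prop
  obtain ⟨θ, hθ⟩ : ∃ θ, φ θ = 0 := by
    -- A slope of at least `m` forces `φ` to change sign on `[-R, R]`.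
    set R := |φ 0| / m with hR
    have hR0 : 0 ≤ R := by positivity
    have hRm : R * m = |φ 0| := div_mul_cancel₀ _ h.ne'
    have h1 : 0 ≤ φ R := by
      have := hmono hR0
      rw [sub_zero, hRm] at this
      linarith [neg_abs_le (φ 0)]
    have h2 : φ (-R) ≤ 0 := by
      have := hmono (neg_nonpos.2 hR0)
      rw [zero_sub, neg_neg, hRm] at this
      linarith [le_abs_self (φ 0)]
    obtain ⟨θ, -, h⟩ := intermediate_value_Icc (by linarith : -R ≤ R) hcont.continuousOn ⟨h2, h1⟩
    exact ⟨θ, h⟩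
  refine ⟨θ, sub_eq_zero.1 hθ, fun θ' hθ' => ?_⟩
  have hθ' : φ θ' = 0 := sub_eq_zero.2 hθ'
  rcases le_total θ θ' with hle | hle
  · have := hmono hle
    rw [hθ, hθ', sub_zero] at this
    nlinarith
  · have := hmono hle
    rw [hθ, hθ', sub_zero] at this
    nlinarith

/-- The threshold function vanishes at `θ`, so its slope bound turns its value at `s` into a
distance. -/
theorem abs_sub_mul_le_of_solvesThreshold {f : Feature d → ℝ} {X : Fin N → Feature d} {θ : ℝ}
    (hθ : SolvesThreshold f X θ) (s : ℝ) :
    |θ - s| * ((1 / (N : ℝ)) * ∑ i, f (X i)) ≤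
      |s * ((1 / (N : ℝ)) * ∑ i, f (X i)) - (1 / (N : ℝ)) * ∑ i, max (f (X i) - s) 0| := by
  have hθ : θ * ((1 / (N : ℝ)) * ∑ i, f (X i)) = (1 / (N : ℝ)) * ∑ i, max (f (X i) - θ) 0 := hθ
  rcases le_total s θ with hle | hle
  · have := thresholdGap_le (f := f) X hle
    rw [abs_of_nonneg (sub_nonneg.2 hle)]
    refine le_trans ?_ (neg_le_abs _)
    linarith
  · have := thresholdGap_le (f := f) X hle
    rw [abs_of_nonpos (sub_nonpos.2 hle)]
    refine le_trans ?_ (le_abs_self _)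
    linarith

/-- The empirical threshold function at `s` is stable under replacing `f` by `e`. -/
theorem abs_threshold_sub_le (f e : Feature d → ℝ) (X : Fin N → Feature d) {s : ℝ}
    (hs0 : 0 ≤ s) (hs1 : s ≤ 1) :
    |s * ((1 / (N : ℝ)) * ∑ i, f (X i)) - (1 / (N : ℝ)) * ∑ i, max (f (X i) - s) 0| ≤
      2 * ((1 / (N : ℝ)) * ∑ i, |f (X i) - e (X i)|) +
        |(1 / (N : ℝ)) * ∑ i, (s * e (X i) - max (e (X i) - s) 0)| := by
  -- Both `s f` and `(f - s)₊` are 1-Lipschitz in `f` because `0 ≤ s ≤ 1`.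
  have key : ∀ i, |(s * f (X i) - max (f (X i) - s) 0) - (s * e (X i) - max (e (X i) - s) 0)| ≤
      2 * |f (X i) - e (X i)| := by
    intro i
    have h1 : |max (f (X i) - s) 0 - max (e (X i) - s) 0| ≤ |f (X i) - e (X i)| := by
      simpa using abs_max_sub_max_le_abs (f (X i) - s) (e (X i) - s) 0
    have h2 : |s * (f (X i) - e (X i))| ≤ |f (X i) - e (X i)| := by
      rw [abs_mul, abs_of_nonneg hs0]
      exact mul_le_of_le_one_left (abs_nonneg _) hs1
    calc _ = |s * (f (X i) - e (X i)) - (max (f (X i) - s) 0 - max (e (X i) - s) 0)| := by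
          congr 1; ring
      _ ≤ _ := (abs_sub _ _).trans (by linarith)
  have heq : s * ((1 / (N : ℝ)) * ∑ i, f (X i)) - (1 / (N : ℝ)) * ∑ i, max (f (X i) - s) 0 =
      (1 / (N : ℝ)) * ∑ i, ((s * f (X i) - max (f (X i) - s) 0) -
        (s * e (X i) - max (e (X i) - s) 0)) +
      (1 / (N : ℝ)) * ∑ i, (s * e (X i) - max (e (X i) - s) 0) := by
    rw [← mul_add, ← Finset.sum_add_distrib]
    simp only [sub_add_cancel]
    rw [Finset.sum_sub_distrib, ← Finset.mul_sum]
    ring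
  rw [heq]
  refine (abs_add_le _ _).trans (add_le_add ?_ le_rfl)
  rw [abs_mul, abs_of_nonneg (by positivity : (0 : ℝ) ≤ 1 / N), mul_left_comm, Finset.mul_sum]
  gcongr
  exact (Finset.abs_sum_le_sum_abs _ _).trans (Finset.sum_le_sum fun i _ => key i)

/-- Deterministic control of the misclassified points: either the empirical threshold is close to
`s`, or the empirical mean of `f` is far from `q`. -/
theorem abs_sub_le_of_misclassified {f e : Feature d → ℝ} {X : Fin N → Feature d} {s p q θ : ℝ}
    (hN : 1 ≤ N) (hs0 : 0 ≤ s) (hs1 : s ≤ 1) (hp : 0 < p) (hpq : p ≤ q)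
    (he0 : ∀ x, 0 ≤ e x) (he1 : ∀ x, e x ≤ 1)
    (hθ : (∃! θ : ℝ, SolvesThreshold f X θ) → SolvesThreshold f X θ)
    {x : Feature d} (hx : ¬(θ < f x ↔ s < e x)) :
    |e x - s| ≤ |f x - e x| + 4 / p * ((1 / (N : ℝ)) * ∑ i, |f (X i) - e (X i)|) +
      4 / p * |(1 / (N : ℝ)) * ∑ i, (s * e (X i) - max (e (X i) - s) 0)| +
      4 / p * |(1 / (N : ℝ)) * ∑ i, (e (X i) - q)| := by
  have hN' : (0 : ℝ) < N := by exact_mod_cast hN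
  set m := (1 / (N : ℝ)) * ∑ i, |f (X i) - e (X i)| with hm
  set z := |(1 / (N : ℝ)) * ∑ i, (s * e (X i) - max (e (X i) - s) 0)| with hz
  set y := |(1 / (N : ℝ)) * ∑ i, (e (X i) - q)| with hy
  set F := (1 / (N : ℝ)) * ∑ i, f (X i) with hF
  have hm0 : 0 ≤ m := by positivity
  have hz0 : 0 ≤ z := abs_nonneg _
  have hy0 : 0 ≤ y := abs_nonneg _
  have hw0 := abs_nonneg (f x - e x)
  -- If `F < p/2`, nothing is known about `θ`, but `m + y ≥ q - F > p/2` makes the bound trivial. If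
  -- `F ≥ p/2`, then `θ` is the root and `|θ - s| ≤ (2/p)(2m + z)`. The factor `4/p` covers both
  -- cases.
  rcases lt_or_ge F (p / 2) with hlt | hge
  · have h1 : q - F ≤ m + y := by
      have : (1 / (N : ℝ)) * ∑ i, (e (X i) - q) = (1 / (N : ℝ)) * ∑ i, e (X i) - q := by
        rw [Finset.sum_sub_distrib]
        simp
        field_simp
      have h2 : (1 / (N : ℝ)) * ∑ i, e (X i) - F ≤ m := by
        rw [hF, hm, ← mul_sub, ← Finset.sum_sub_distrib]
        gcongr with i
        rw [abs_sub_comm]; exact le_abs_self _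
      have h3 := neg_abs_le ((1 / (N : ℝ)) * ∑ i, (e (X i) - q))
      rw [← hy] at h3
      linarith
    have h2 : |e x - s| ≤ 1 := abs_le.2 ⟨by linarith [he0 x], by linarith [he1 x]⟩
    have h3 : 1 ≤ 4 / p * (m + y) := by
      rw [div_mul_eq_mul_div, le_div_iff₀ hp]
      linarith
    have h4 : 0 ≤ 4 / p * z := by positivity
    linarith
  · have hF0 : 0 < F := by linarith
    have h1 := abs_sub_mul_le_of_solvesThreshold (hθ (existsUnique_solvesThreshold hF0)) s
    have h2 := abs_threshold_sub_le f e X hs0 hs1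
    have h3 : |θ - s| * (p / 2) ≤ 2 * m + z :=
      (mul_le_mul_of_nonneg_left hge (abs_nonneg _)).trans (h1.trans h2)
    have h4 : |θ - s| ≤ 4 / p * m + 4 / p * z := by
      rw [← mul_add, div_mul_eq_mul_div, le_div_iff₀ hp]
      linarith
    have h5 : |e x - s| ≤ |f x - e x| + |θ - s| := by
      rcases le_or_gt (f x) θ with h | h
      · have : s < e x := by by_contra hc; exact hx ⟨fun h' => absurd h' h.not_gt, fun h' => absurd h' hc⟩
        rw [abs_of_pos (sub_pos.2 this)]
        linarith [neg_abs_le (f x - e x), le_abs_self (θ - s)]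
      · have : e x ≤ s := by by_contra hc; exact hx ⟨fun _ => not_le.1 hc, fun _ => h⟩
        rw [abs_of_nonpos (sub_nonpos.2 this)]
        linarith [le_abs_self (f x - e x), neg_abs_le (θ - s)]
    have h6 : 0 ≤ 4 / p * y := by positivity
    linarith

end Threshold

end FScore
-- Gaussian tails of the four deviations.
namespace FScore

section Tails

variable {d n N : ℕ} {P : Measure (Labeled d)} [IsProbabilityMeasure P]

/-- The almost sure set in the concentration hypothesis can be chosen independently of `t`. -/
theorem Concentrates.ae_forall {etaHat : RegressionEstimator d n} {C₁ C₂ a : ℝ}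
    (h : Concentrates P etaHat C₁ C₂ a) :
    ∀ᵐ x ∂P.fst, ∀ t : ℝ, 0 < t →
      (Measure.pi fun _ : Fin n => P).real {D | t ≤ |etaHat.toFun D x - eta P x|}
        ≤ C₁ * Real.exp (-C₂ * a * t ^ 2) := by
  -- Countably many rational levels share one null set; a real `t` is reached from rationals below
  -- it, by monotonicity of the event and continuity of the bound.
  have hq : ∀ᵐ x ∂P.fst, ∀ q : ℚ, 0 < (q : ℝ) →
      (Measure.pi fun _ : Fin n => P).real {D | (q : ℝ) ≤ |etaHat.toFun D x - eta P x|}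
        ≤ C₁ * Real.exp (-C₂ * a * (q : ℝ) ^ 2) :=
    ae_all_iff.2 fun q => by
      by_cases hq : 0 < (q : ℝ)
      · filter_upwards [h q hq] with x hx _ using hx
      · exact ae_of_all _ fun x h => absurd h hq
  filter_upwards [hq] with x hx t ht
  have hcont : Filter.Tendsto (fun s : ℝ => C₁ * Real.exp (-C₂ * a * s ^ 2)) (nhdsWithin t (Set.Iio t))
      (nhds (C₁ * Real.exp (-C₂ * a * t ^ 2))) :=
    (Continuous.tendsto (by fun_prop) t).mono_left nhdsWithin_le_nhds
  refine le_of_forall_pos_le_add fun ε hε => ?_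
  have hev := (hcont.eventually (gt_mem_nhds (lt_add_of_pos_right _ hε))).and
    (Ioo_mem_nhdsLT ht)
  obtain ⟨s, hs, hst⟩ := mem_nhdsLT_iff_exists_Ioo_subset.1 hev
  obtain ⟨q, hq1, hq2⟩ := exists_rat_btwn (Set.mem_Iio.1 hs)
  obtain ⟨h1, h2⟩ := hst ⟨hq1, hq2⟩
  refine le_trans ?_ ((hx q h2.1).trans h1.le)
  exact measureReal_mono fun D hD => hq2.le.trans hD

theorem measurable_deviation (etaHat : RegressionEstimator d n) :
    Measurable (Function.uncurry fun D x => |etaHat.toFun D x - eta P x|) :=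
  (etaHat.measurable.sub ((measurable_eta P).comp measurable_snd)).norm

theorem sampleLaw_fst_preimage {s : Set (Fin n → Labeled d)} (hs : MeasurableSet s) :
    sampleLaw P n N {S | S.1 ∈ s} = (Measure.pi fun _ : Fin n => P) s :=
  (measurePreserving_fst (μ := Measure.pi fun _ : Fin n => P)
    (ν := Measure.pi fun _ : Fin N => P.fst)).measure_preimage hs.nullMeasurableSet

theorem sampleLaw_snd_preimage {s : Set (Fin N → Feature d)} (hs : MeasurableSet s) :
    sampleLaw P n N {S | S.2 ∈ s} = (Measure.pi fun _ : Fin N => P.fst) s :=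
  (measurePreserving_snd (μ := Measure.pi fun _ : Fin n => P)
    (ν := Measure.pi fun _ : Fin N => P.fst)).measure_preimage hs.nullMeasurableSet

theorem sampleLaw_deviation_le {etaHat : RegressionEstimator d n} {C₁ C₂ a : ℝ}
    (h : Concentrates P etaHat C₁ C₂ a) :
    ∀ᵐ x ∂P.fst, ∀ t : ℝ, 0 < t →
      sampleLaw P n N {S | t ≤ 4 * |etaHat.toFun S.1 x - eta P x|}
        ≤ ENNReal.ofReal (max C₁ 1 * Real.exp (-(C₂ / 16) * a * t ^ 2)) := by
  filter_upwards [h.ae_forall] with x hx t ht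
  have hs : MeasurableSet {D | t ≤ 4 * |etaHat.toFun D x - eta P x|} :=
    measurableSet_le measurable_const
      (((measurable_deviation (P := P) etaHat).comp measurable_prodMk_right).const_mul 4)
  refine (sampleLaw_fst_preimage hs).trans_le ?_
  rw [← ofReal_measureReal]
  refine ENNReal.ofReal_le_ofReal ?_
  have hset : {D | t ≤ 4 * |etaHat.toFun D x - eta P x|} =
      {D | t / 4 ≤ |etaHat.toFun D x - eta P x|} := by
    ext D; simp only [Set.mem_ofPred_eq]; constructor <;> intro _ <;> linarith
  rw [hset]
  refine (hx (t / 4) (by positivity)).trans ?_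
  rw [show -C₂ * a * (t / 4) ^ 2 = -(C₂ / 16) * a * t ^ 2 by ring]
  gcongr
  exact le_max_left _ _

/-- The square-exponential moment is taken at `l = C₂ a / 2` and the mean must exceed `t p / 16`,
whence the constant `512`. -/
theorem sampleLaw_mean_deviation_le {etaHat : RegressionEstimator d n} {C₁ C₂ a p : ℝ}
    (h : Concentrates P etaHat C₁ C₂ a) (hC₂ : 0 < C₂) (ha : 0 < a) (hp : 0 < p) (hN : 1 ≤ N)
    {t : ℝ} (ht : 0 < t) :
    sampleLaw P n N {S | t ≤ 4 * (4 / p * ((1 / (N : ℝ)) *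
        ∑ i, |etaHat.toFun S.1 (S.2 i) - eta P (S.2 i)|))}
      ≤ ENNReal.ofReal (max C₁ 1 * (∑' k : ℕ, Real.exp (1 - k)) *
        Real.exp (-(C₂ * p ^ 2 / 512) * a * t ^ 2)) := by
  have hexp : ∀ᵐ x ∂P.fst, ∫⁻ D, ENNReal.ofReal
      (Real.exp (C₂ * a / 2 * |etaHat.toFun D x - eta P x| ^ 2)) ∂(Measure.pi fun _ : Fin n => P)
      ≤ ENNReal.ofReal (max C₁ 1 * ∑' k : ℕ, Real.exp (1 - k)) := by
    filter_upwards [h.ae_forall] with x hx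
    refine lintegral_exp_mul_sq_le _ (W := fun D => |etaHat.toFun D x - eta P x|)
      ((measurable_deviation (P := P) etaHat).comp measurable_prodMk_right)
      (fun _ => abs_nonneg _) (le_max_right _ _) (by positivity) fun t ht => ?_
    refine (hx t ht).trans ?_
    rw [show -C₂ * a * t ^ 2 = -(2 * (C₂ * a / 2)) * t ^ 2 by ring]
    gcongr
    exact le_max_left _ _
  have := prod_pi_mean_ge_le (Measure.pi fun _ : Fin n => P) P.fst
    (measurable_deviation (P := P) etaHat) (by positivity) hexp hN
    (show 0 < t * p / 16 by positivity)
  rw [show -(C₂ * a / 2) * (t * p / 16) ^ 2 = -(C₂ * p ^ 2 / 512) * a * t ^ 2 by ring] at this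
  refine le_trans (measure_mono fun S hS => ?_) this
  have hS : t ≤ 4 * (4 / p * ((1 / (N : ℝ)) *
    ∑ i, |etaHat.toFun S.1 (S.2 i) - eta P (S.2 i)|)) := hS
  rw [div_mul_eq_mul_div, mul_div_assoc', le_div_iff₀ hp] at hS
  simp only [Set.mem_ofPred_eq]
  linarith

theorem sampleLaw_abs_mean_le {z : Feature d → ℝ} (hz : Measurable z) (hz1 : ∀ x, |z x| ≤ 1)
    (hz0 : ∫ x, z x ∂P.fst = 0) {p : ℝ} (hp : 0 < p) (hN : 1 ≤ N) {t : ℝ} (ht : 0 < t) :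
    sampleLaw P n N {S | t ≤ 4 * (4 / p * |(1 / (N : ℝ)) * ∑ i, z (S.2 i)|)}
      ≤ ENNReal.ofReal (2 * Real.exp (-(p ^ 2 / 512) * N * t ^ 2)) := by
  have hm : Measurable fun x : Fin N → Feature d => |(1 / (N : ℝ)) * ∑ i, z (x i)| :=
    ((Finset.measurable_sum _ fun i _ => hz.comp (measurable_pi_apply i)).const_mul _).norm
  have hs : MeasurableSet {x : Fin N → Feature d |
      t ≤ 4 * (4 / p * |(1 / (N : ℝ)) * ∑ i, z (x i)|)} :=
    measurableSet_le measurable_const ((hm.const_mul _).const_mul _)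
  have := pi_abs_mean_ge_le P.fst hz (ae_of_all _ hz1) hz0 hN (show 0 < t * p / 16 by positivity)
  rw [show -(1 / 2) * (N : ℝ) * (t * p / 16) ^ 2 = -(p ^ 2 / 512) * N * t ^ 2 by ring] at this
  refine (sampleLaw_snd_preimage hs).trans_le (le_trans (measure_mono fun x hx => ?_) this)
  have hx : t ≤ 4 * (4 / p * |(1 / (N : ℝ)) * ∑ i, z (x i)|) := hx
  rw [div_mul_eq_mul_div, mul_div_assoc', le_div_iff₀ hp] at hx
  simp only [Set.mem_ofPred_eq]
  linarith

end Tails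

/-! ### From deviations to the expected excess score. -/

section Risk

variable {d n N : ℕ} (P : Measure (Labeled d)) [IsProbabilityMeasure P]

theorem plugIn_eq_one_iff {f : Feature d → ℝ} {θ : ℝ} {x : Feature d} :
    plugIn f θ x = 1 ↔ θ < f x := by
  by_cases h : θ < f x <;> simp [plugIn, h]

theorem measurable_plugIn {Ω : Type*} [MeasurableSpace Ω] {f : Ω → Feature d → ℝ} {θ : Ω → ℝ}
    (hf : Measurable (Function.uncurry f)) (hθ : Measurable θ) :
    Measurable (Function.uncurry fun ω x => plugIn (f ω) (θ ω) x) := by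
  classical
  refine Measurable.ite ?_ measurable_const measurable_const
  exact measurableSet_lt (hθ.comp measurable_fst) hf

theorem measurable_plugIn_estimator {etaHat : RegressionEstimator d n}
    (thetaHat : ThresholdEstimator etaHat N) :
    Measurable (Function.uncurry fun (S : (Fin n → Labeled d) × (Fin N → Feature d)) x =>
      plugIn (etaHat.toFun S.1) (thetaHat.toFun S.1 S.2) x) := by
  have hf : Measurable (Function.uncurry
      fun (S : (Fin n → Labeled d) × (Fin N → Feature d)) x => etaHat.toFun S.1 x) :=
    etaHat.measurable.comp ((measurable_fst.comp measurable_fst).prodMk measurable_snd)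
  exact measurable_plugIn hf thetaHat.measurable

theorem measurable_fOne {Ω : Type*} [MeasurableSpace Ω] {g : Ω → Feature d → Fin 2}
    (hg : Measurable (Function.uncurry g)) : Measurable fun ω => fOne P (g ω) := by
  have hs : MeasurableSet {q : Ω × Labeled d | g q.1 q.2.1 = 1} :=
    (hg.comp (measurable_fst.prodMk (measurable_fst.comp measurable_snd)))
      (measurableSet_singleton 1)
  have hl : MeasurableSet {q : Ω × Labeled d | q.2.2 = 1} :=
    (measurable_snd.comp measurable_snd) (measurableSet_singleton 1)
  exact ((measurable_measure_prodMk_left (hl.inter hs)).ennreal_toReal).div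
    (measurable_const.add (measurable_measure_prodMk_left hs).ennreal_toReal)

variable {P}

/-- The supremum does not depend on `ω`, so only the bounded measurable score of `g ω` matters. -/
theorem integrable_excess {Ω : Type*} [MeasurableSpace Ω] (ν : Measure Ω) [IsFiniteMeasure ν]
    (hP : 0 < probOne P) {g : Ω → Feature d → Fin 2} (hg : Measurable (Function.uncurry g)) :
    Integrable (fun ω => excess P (g ω)) ν := by
  refine (integrable_const _).sub (Integrable.of_mem_Icc 0 1 (measurable_fOne P hg).aemeasurable
    (ae_of_all _ fun ω => ⟨fOne_nonneg P _, ?_⟩))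
  exact (fOne_le_thetaStar hP (hg.comp measurable_prodMk_left)).trans (thetaStar_le_one P)

theorem lintegral_excess_plugIn_le {α C₀ δ₀ C₁ C₂ p a : ℝ} (hα : 0 ≤ α) (hδ₀ : 0 < δ₀)
    (hC₀ : 0 < C₀) (hC₂ : 0 < C₂) (hp : 0 < p) (hP : p ≤ probOne P) (ha : 0 < a)
    (hmargin : MarginCondition P α C₀ δ₀) {etaHat : RegressionEstimator d n}
    (hconc : Concentrates P etaHat C₁ C₂ a) (hN : 1 ≤ N) (thetaHat : ThresholdEstimator etaHat N) :
    ∫⁻ S, ENNReal.ofReal (excess P (plugIn (etaHat.toFun S.1) (thetaHat.toFun S.1 S.2)))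
        ∂(sampleLaw P n N) ≤
      ENNReal.ofReal (1 / p * (
        max C₁ 1 * (max C₀ ((δ₀ ^ α)⁻¹) * marginSeries (1 + α) (C₂ / 16) * a ^ (-(1 + α) / 2)) +
        max C₁ 1 * (∑' k : ℕ, Real.exp (1 - k)) * (max C₀ ((δ₀ ^ α)⁻¹) *
          marginSeries (1 + α) (C₂ * p ^ 2 / 512) * a ^ (-(1 + α) / 2)) +
        2 * (max C₀ ((δ₀ ^ α)⁻¹) * marginSeries (1 + α) (p ^ 2 / 512) *
          (N : ℝ) ^ (-(1 + α) / 2)) +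
        2 * (max C₀ ((δ₀ ^ α)⁻¹) * marginSeries (1 + α) (p ^ 2 / 512) *
          (N : ℝ) ^ (-(1 + α) / 2)))) := by
  have hN' : (0 : ℝ) < N := by exact_mod_cast hN
  have hK : 0 ≤ max C₀ ((δ₀ ^ α)⁻¹) := hC₀.le.trans (le_max_left _ _)
  have hA : (0 : ℝ) ≤ max C₁ 1 := zero_le_one.trans (le_max_right _ _)
  have hE : (0 : ℝ) ≤ ∑' k : ℕ, Real.exp (1 - k) := tsum_nonneg fun k => (Real.exp_pos _).le
  have hms := fun c => marginSeries_nonneg (1 + α) c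
  have hη := measurable_eta P
  have hu : Measurable fun x => |eta P x - thetaStar P| := (hη.sub_const _).norm
  have hmg : ∀ δ : ℝ, 0 < δ → P.fst {x | 0 < |eta P x - thetaStar P| ∧
      |eta P x - thetaStar P| ≤ δ} ≤ ENNReal.ofReal (max C₀ ((δ₀ ^ α)⁻¹) * δ ^ α) :=
    fun δ hδ => margin_ofReal hα hδ₀ hmargin hδ
  -- Only `v₁` varies with `x`. The deviations `v₁`, `v₂` concentrate at rate `a`, and `v₃`, `v₄` at
  -- rate `N`.
  set v₁ : (Fin n → Labeled d) × (Fin N → Feature d) → Feature d → ℝ :=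
    fun S x => |etaHat.toFun S.1 x - eta P x| with hv₁
  set v₂ : (Fin n → Labeled d) × (Fin N → Feature d) → Feature d → ℝ :=
    fun S _ => 4 / p * ((1 / (N : ℝ)) *
      ∑ i, |etaHat.toFun S.1 (S.2 i) - eta P (S.2 i)|) with hv₂
  set v₃ : (Fin n → Labeled d) × (Fin N → Feature d) → Feature d → ℝ :=
    fun S _ => 4 / p * |(1 / (N : ℝ)) * ∑ i, (thetaStar P * eta P (S.2 i) -
      max (eta P (S.2 i) - thetaStar P) 0)| with hv₃
  set v₄ : (Fin n → Labeled d) × (Fin N → Feature d) → Feature d → ℝ :=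
    fun S _ => 4 / p * |(1 / (N : ℝ)) * ∑ i, (eta P (S.2 i) - probOne P)| with hv₄
  have hz : Measurable fun x => thetaStar P * eta P x - max (eta P x - thetaStar P) 0 :=
    (hη.const_mul _).sub ((hη.sub_const _).max measurable_const)
  have hdev := measurable_deviation (P := P) etaHat
  have hSi : ∀ i : Fin N, Measurable fun q : ((Fin n → Labeled d) × (Fin N → Feature d)) ×
      Feature d => q.1.2 i := fun i =>
    (measurable_pi_apply i).comp (measurable_snd.comp measurable_fst)
  have hm₁ : Measurable (Function.uncurry v₁) :=
    hdev.comp ((measurable_fst.comp measurable_fst).prodMk measurable_snd)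
  have hm₂ : Measurable (Function.uncurry v₂) :=
    ((Finset.measurable_sum _ fun i _ => hdev.comp
      ((measurable_fst.comp measurable_fst).prodMk (hSi i))).const_mul _).const_mul _
  have hm₃ : Measurable (Function.uncurry v₃) :=
    (((Finset.measurable_sum _ fun i _ => hz.comp (hSi i)).const_mul _).norm).const_mul _
  have hm₄ : Measurable (Function.uncurry v₄) :=
    (((Finset.measurable_sum _ fun i _ => (hη.sub_const _).comp
      (hSi i)).const_mul _).norm).const_mul _
  have : IsProbabilityMeasure (sampleLaw P n N) := by unfold sampleLaw; infer_instance
  have b₁ := lintegral_lintegral_margin_le (sampleLaw P n N) P.fst hu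
    (V := fun S x => 4 * v₁ S x) (hm₁.const_mul 4) hK hA
    (by positivity) ha hmg (sampleLaw_deviation_le hconc)
  have b₂ := lintegral_lintegral_margin_le (sampleLaw P n N) P.fst hu
    (V := fun S x => 4 * v₂ S x) (hm₂.const_mul 4) hK (mul_nonneg hA hE)
    (by positivity) ha hmg
    (ae_of_all _ fun x t ht => sampleLaw_mean_deviation_le hconc hC₂ ha hp hN ht)
  have b₃ := lintegral_lintegral_margin_le (sampleLaw P n N) P.fst hu
    (V := fun S x => 4 * v₃ S x) (hm₃.const_mul 4) hK zero_le_two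
    (by positivity) hN' hmg (ae_of_all _ fun x t ht =>
      sampleLaw_abs_mean_le hz abs_threshold_score_le integral_threshold_score hp hN ht)
  have b₄ := lintegral_lintegral_margin_le (sampleLaw P n N) P.fst hu
    (V := fun S x => 4 * v₄ S x) (hm₄.const_mul 4) hK zero_le_two
    (by positivity) hN' hmg (ae_of_all _ fun x t ht =>
      sampleLaw_abs_mean_le (z := fun x => eta P x - probOne P) (hη.sub_const _)
        (fun x => abs_le.2 ⟨by
          linarith [eta_nonneg P x, measureReal_le_one (μ := P) (s := {z | z.2 = 1}),
            show probOne P = P.real {z | z.2 = 1} from rfl], by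
          linarith [eta_le_one P x, hp.trans_le hP]⟩)
        (by rw [integral_sub (integrable_eta P) (integrable_const _), integral_eta]; simp)
        hp hN ht)
  have hg := measurable_plugIn_estimator thetaHat
  have hpt : ∀ S : (Fin n → Labeled d) × (Fin N → Feature d),
      ENNReal.ofReal (excess P (plugIn (etaHat.toFun S.1) (thetaHat.toFun S.1 S.2))) ≤
        ENNReal.ofReal (1 / p) * ∫⁻ x, marginPart (fun x => |eta P x - thetaStar P|)
          (fun S x => v₁ S x + v₂ S x + v₃ S x + v₄ S x) S x ∂P.fst := by
    intro S
    refine ofReal_excess_le (V := fun x => v₁ S x + v₂ S x + v₃ S x + v₄ S x) hp hP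
      (hg.comp measurable_prodMk_left) fun x hx => ?_
    simp only [Function.comp_apply, Function.uncurry_apply_pair, plugIn_eq_one_iff] at hx
    exact abs_sub_le_of_misclassified hN (thetaStar_nonneg P) (thetaStar_le_one P) hp hP
      (eta_nonneg P) (eta_le_one P) (thetaHat.solves S.1 S.2) hx
  refine (lintegral_mono hpt).trans ?_
  rw [lintegral_const_mul' _ _ ENNReal.ofReal_ne_top]
  refine (mul_le_mul_right (lintegral_lintegral_marginPart_add_le _ _ hu hm₁ hm₂ hm₃) _).trans ?_
  have h₁ := hms (C₂ / 16)
  have h₂ := hms (C₂ * p ^ 2 / 512)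
  have h₃ := hms (p ^ 2 / 512)
  rw [ENNReal.ofReal_mul (by positivity), ENNReal.ofReal_add (by positivity) (by positivity),
    ENNReal.ofReal_add (by positivity) (by positivity),
    ENNReal.ofReal_add (by positivity) (by positivity)]
  gcongr

end Risk

end FScore

theorem mainTheorem3 (α C₀ δ₀ C₁ C₂ p : ℝ) (hα : 0 ≤ α) (hC₀ : 0 < C₀)
    (hδ₀ : 0 < δ₀) (hδ₀' : δ₀ ≤ 1 / 12) (hC₁ : 0 < C₁) (hC₂ : 0 < C₂) (hp : 0 < p) :
    ∃ C : ℝ, 0 < C ∧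
      ∀ (d : ℕ) (P : Measure (FScore.Labeled d)) [IsProbabilityMeasure P],
        p ≤ FScore.probOne P →
        FScore.MarginCondition P α C₀ δ₀ →
        ∀ a : ℕ → ℝ, Monotone a → (∀ n, 1 ≤ n → 0 < a n) →
        ∀ etaHat : (n : ℕ) → FScore.RegressionEstimator d n,
          (∀ n, 1 ≤ n → FScore.Concentrates P (etaHat n) C₁ C₂ (a n)) →
          ∀ n N : ℕ, 1 ≤ n → 1 ≤ N →
          ∀ thetaHat : FScore.ThresholdEstimator (etaHat n) N,
            Integrable (fun S : (Fin n → FScore.Labeled d) × (Fin N → FScore.Feature d) =>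
                FScore.excess P
                  (FScore.plugIn ((etaHat n).toFun S.1) (thetaHat.toFun S.1 S.2)))
              (FScore.sampleLaw P n N) ∧
            ∫ S, FScore.excess P
                (FScore.plugIn ((etaHat n).toFun S.1) (thetaHat.toFun S.1 S.2))
              ∂(FScore.sampleLaw P n N)
              ≤ C * (a n ^ (-(1 + α) / 2) + (N : ℝ) ^ (-(1 + α) / 2)) := by
  set K := max C₀ ((δ₀ ^ α)⁻¹) with hK
  set E : ℝ := ∑' k : ℕ, Real.exp (1 - k) with hE
  have hK0 : 0 < K := hC₀.trans_le (le_max_left _ _)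
  have hA0 : (0 : ℝ) < max C₁ 1 := one_pos.trans_le (le_max_right _ _)
  have hE0 : 0 ≤ E := tsum_nonneg fun k => (Real.exp_pos _).le
  have h₁ := marginSeries_nonneg (1 + α) (C₂ / 16)
  have h₂ := marginSeries_nonneg (1 + α) (C₂ * p ^ 2 / 512)
  have h₃ := marginSeries_nonneg (1 + α) (p ^ 2 / 512)
  set B₁ := 1 / p * (max C₁ 1 * (K * marginSeries (1 + α) (C₂ / 16)) +
    max C₁ 1 * E * (K * marginSeries (1 + α) (C₂ * p ^ 2 / 512))) with hB₁
  set B₂ := 1 / p * (4 * (K * marginSeries (1 + α) (p ^ 2 / 512))) with hB₂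
  have hB₁0 : 0 ≤ B₁ := by positivity
  have hB₂0 : 0 ≤ B₂ := by positivity
  -- `B₁` and `B₂` are the coefficients of the two rates, known here only to be nonnegative; the `1`
  -- makes the constant positive.
  refine ⟨B₁ + B₂ + 1, by positivity, ?_⟩
  intro d P _ hP hmargin a _ ha etaHat hconc n N hn hN thetaHat
  have hP0 := hp.trans_le hP
  have han := ha n hn
  have hg := FScore.measurable_plugIn_estimator thetaHat
  have : IsProbabilityMeasure (FScore.sampleLaw P n N) := by
    unfold FScore.sampleLaw; infer_instance
  have hint := FScore.integrable_excess (FScore.sampleLaw P n N) hP0 hg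
  refine ⟨hint, ?_⟩
  have h0 : ∀ S : (Fin n → FScore.Labeled d) × (Fin N → FScore.Feature d), 0 ≤ FScore.excess P
      (FScore.plugIn ((etaHat n).toFun S.1) (thetaHat.toFun S.1 S.2)) := fun S =>
    FScore.excess_nonneg hP0 (hg.comp measurable_prodMk_left)
  rw [integral_eq_lintegral_of_nonneg_ae (ae_of_all _ h0) hint.aestronglyMeasurable]
  have hx : 0 ≤ a n ^ (-(1 + α) / 2) := Real.rpow_nonneg han.le _
  have hy : 0 ≤ (N : ℝ) ^ (-(1 + α) / 2) := by positivity
  refine ENNReal.toReal_le_of_le_ofReal (by positivity)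
    ((FScore.lintegral_excess_plugIn_le hα hδ₀ hC₀ hC₂ hp hP han hmargin (hconc n hn) hN
      thetaHat).trans (ENNReal.ofReal_le_ofReal ?_))
  rw [← hK, ← hE]
  calc _ = B₁ * a n ^ (-(1 + α) / 2) + B₂ * (N : ℝ) ^ (-(1 + α) / 2) := by
        rw [hB₁, hB₂]; ring
    _ ≤ _ := by nlinarith [mul_nonneg hB₁0 hy, mul_nonneg hB₂0 hx]
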